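/- Let $d\ge 2$ and $n\ge 2$ be integers, let $|0\rangle,\dots,|d-1\rangle$ be the standard basis of $\mathbb{C}^d$, and consider the (unnormalized) $n$-qudit states in $(\mathbb{C}^d)^{\otimes n}$ $$\mathcal{L}(d,n)=\sum_{j_1+\cdots+j_n=d-1}|j_1\cdots j_n\rangle,$$ $$\mathcal{M}(d,n)=\sum_{i=0}^{n-1}|0\rangle^{\otimes(n-i-1)}|d-1\rangle|0\rangle^{\otimes i}+\sum_{i+k+l=n-2}\ \sum_{j=1}^{d-2}|0\rangle^{\otimes i}|j\rangle|0\rangle^{\otimes k}|d-j-1\rangle|0\rangle^{\otimes l},$$ $$\mathcal{N}(d,n)=|0\rangle^{\otimes(n-1)}|d-1\rangle+\sum_{i=0}^{n-2}\sum_{j=1}^{d-1}|0\rangle^{\otimes(n-i-2)}|j\rangle|0\rangle^{\otimes i}|d-j-1\rangle.$$ For $n$-partite states $\psi\in U_1\otimes\cdots\otimes U_n$ and $\varphi\in V_1\otimes\cdots\otimes V_n$ write $\psi\xrightarrow{\mathrm{SLOCC}}\varphi$ if $(A_1\otimes\cdots\otimes A_n)\psi=\varphi$ for some linear maps $A_i:U_i\to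 V_i$. Let $\psi^{\boxtimes m}$ be the $m$-fold Kronecker power of $\psi$, that is, $\psi^{\otimes m}$ regarded as an $n$-partite state whose $i$-th party holds $U_i^{\otimes m}$, and let $$\omega(\psi,\varphi)=\lim_{N\to\infty}\frac1N\inf\left\{m\in\mathbb{N}\ \middle|\ \psi^{\boxtimes m}\xrightarrow{\mathrm{SLOCC}}\varphi^{\boxtimes N}\right\}$$ (with $\inf\emptyset=\infty$). Then the limits defining the following rates exist, and $$\omega(\mathcal{L}(d,n),\mathcal{M}(d,n))=1,\qquad \omega(\mathcal{M}(d,n),\mathcal{N}(d,n))=1,\qquad \omega(\mathcal{L}(d,n),\mathcal{N}(d,n))=1.$$ -/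

import Mathlib

open scoped TensorProduct

noncomputable section

namespace MultiquditSLOCC

section General

variable {n : ℕ} {U V : Fin n → Type}
  [∀ i, AddCommGroup (U i)] [∀ i, Module ℂ (U i)]
  [∀ i, AddCommGroup (V i)] [∀ i, Module ℂ (V i)]

/-- `ψ` can be transformed into `φ` by SLOCC: `(A₁ ⊗ ⋯ ⊗ Aₙ) ψ = φ` for some linear maps
`Aᵢ : Uᵢ → Vᵢ`. -/
def SLOCC (ψ : ⨂[ℂ] i, U i) (φ : ⨂[ℂ] i, V i) : Prop :=
  ∃ A : ∀ i, U i →ₗ[ℂ] V i, PiTensorProduct.map A ψ = φ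

/-- The Kronecker product `ψ ⊠ φ` of two `n`-partite tensors: again an `n`-partite tensor, the
`i`-th party holding `Uᵢ ⊗ Vᵢ`.  On product tensors,
`(⨂ uᵢ) ⊠ (⨂ vᵢ) = ⨂ (uᵢ ⊗ vᵢ)`. -/
def kron (ψ : ⨂[ℂ] i, U i) (φ : ⨂[ℂ] i, V i) : ⨂[ℂ] i, (U i ⊗[ℂ] V i) :=
  PiTensorProduct.map₂ (fun i => TensorProduct.mk ℂ (U i) (V i)) ψ φ

/-- The canonical isomorphism `W^{⊗m} ⊗ W ≃ W^{⊗(m+1)}`. -/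
def appendFactor (W : Type) [AddCommGroup W] [Module ℂ W] (m : ℕ) :
    (⨂[ℂ]^m W) ⊗[ℂ] W ≃ₗ[ℂ] ⨂[ℂ]^(m + 1) W :=
  (TensorProduct.congr (LinearEquiv.refl ℂ (⨂[ℂ]^m W))
    (PiTensorProduct.subsingletonEquiv (R := ℂ) (s := fun _ : Fin 1 => W) 0).symm).trans
    (TensorPower.mulEquiv (R := ℂ) (M := W) (n := m) (m := 1))

/-- The Kronecker power `ψ^{⊠m} = ψ ⊠ ⋯ ⊠ ψ` (`m` copies of the `n`-partite state `ψ`), an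
`n`-partite tensor whose `i`-th party holds `Uᵢ^{⊗m}`. -/
def kronPow (ψ : ⨂[ℂ] i, U i) : (m : ℕ) → ⨂[ℂ] i, (⨂[ℂ]^m (U i))
  | 0 => PiTensorProduct.tprod ℂ (fun _ => PiTensorProduct.tprod ℂ Fin.elim0)
  | m + 1 => PiTensorProduct.map (fun i => (appendFactor (U i) m).toLinearMap)
      (kron (kronPow ψ m) ψ)

open scoped ENNReal in
/-- `inf { m ∈ ℕ | ψ^{⊠m} → φ^{⊠N} by SLOCC }`, which is `∞` if there is no such `m`. -/
def minCopies (ψ : ⨂[ℂ] i, U i) (φ : ⨂[ℂ] i, V i) (N : ℕ) : ℝ≥0∞ :=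
  ⨅ m ∈ {m : ℕ | SLOCC (kronPow ψ m) (kronPow φ N)}, (m : ℝ≥0∞)

open scoped ENNReal in
/-- `ω(ψ, φ) = r`: the limit
`lim_{N → ∞} (1/N) inf { m ∈ ℕ | ψ^{⊠m} → φ^{⊠N} by SLOCC }` exists and equals `r`. -/
def HasSLOCCRate (ψ : ⨂[ℂ] i, U i) (φ : ⨂[ℂ] i, V i) (r : ℝ≥0∞) : Prop :=
  Filter.Tendsto (fun N : ℕ => minCopies ψ φ N / (N : ℝ≥0∞)) Filter.atTop (nhds r)

end General

/-- The space `(ℂ^d)^{⊗n}` of (unnormalized) `n`-qudit states. -/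
abbrev Qudits (d n : ℕ) : Type := ⨂[ℂ] _ : Fin n, (Fin d → ℂ)

/-- The vector `|j⟩` of the computational basis of `ℂ^d`, for `j < d`. -/
def ket (d j : ℕ) : Fin d → ℂ := fun k => if (k : ℕ) = j then 1 else 0

/-- The product basis vector `|j₁ ⋯ jₙ⟩`. -/
def kets {n : ℕ} (d : ℕ) (J : Fin n → ℕ) : Qudits d n :=
  PiTensorProduct.tprod ℂ (fun i => ket d (J i))

/-- `L(d,n) = ∑_{j₁ + ⋯ + jₙ = d-1} |j₁ ⋯ jₙ⟩`. -/
def stateL (d n : ℕ) : Qudits d n :=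
  ∑ J ∈ Finset.piAntidiag (Finset.univ : Finset (Fin n)) (d - 1), kets d J

/-- `M(d,n)`: the sum of all `|0⋯0 (d-1) 0⋯0⟩` and of all
`|0⋯0 j 0⋯0 (d-j-1) 0⋯0⟩` with `1 ≤ j ≤ d-2`, for all (ordered) positions. -/
def stateM (d n : ℕ) : Qudits d n :=
  (∑ i : Fin n, kets d (Pi.single i (d - 1))) +
    ∑ i : Fin n, ∑ k ∈ Finset.Ioi i, ∑ j ∈ Finset.Icc 1 (d - 2),
      kets d (Pi.single i j + Pi.single k (d - j - 1))

/-- `N(d,n)`: the sum of `|0⋯0 (d-1)⟩` and of all `|0⋯0 j 0⋯0 (d-j-1)⟩` with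
`1 ≤ j ≤ d-1`, where `j` stands at any position but the last and `d-j-1` at the last one. -/
def stateN (d : ℕ) : (n : ℕ) → Qudits d n
  | 0 => 0
  | n + 1 => kets d (Pi.single (Fin.last n) (d - 1)) +
      ∑ i : Fin n, ∑ j ∈ Finset.Icc 1 (d - 1),
        kets d (Pi.single i.castSucc j + Pi.single (Fin.last n) (d - j - 1))

end MultiquditSLOCC

end

/-!
All states here are sums `∑_{J ∈ S} |J₁ ⋯ Jₙ⟩` over sets `S` of labels of total `d - 1`, and the
label sets satisfy `N ⊆ M ⊆ L`.  In all three, the last party `h` is a *hub* (`IsHub`): projecting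
the parties other than `h` and some `i ≠ h` onto `|0⟩` leaves the maximally entangled pair
`∑ⱼ |j⟩|d-1-j⟩` of `i` and `h`.  Both bounds on the rate use hubs.

*Lower bound* (`IsHub.le_of_SLOCC`).  Contracting the pair of `h` with one other party shows that
the target `φ` is concise at `h`, and so are its Kronecker powers.  A transformation
`ψ^{⊠m} → φ^{⊠N}` therefore acts at `h` by a surjection `(ℂ^d)^{⊗m} → (ℂ^d)^{⊗N}`, whence `N ≤ m`
(`finrank_pow_le_of_SLOCC`).

*Upper bound* (`IsHub.SLOCC_of_weight`).  There are weights on the local basis vectors for which the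
labels of the target are exactly those labels of the source which have the least total weight `a`
(`weightM_spec`, `weightN_spec`).  Scaling the basis vectors by `z ^ weight` turns `ψ^{⊠N}` into a
polynomial in `z` of degree at most `e * N`, for a constant `e`, and its coefficient at
`z ^ (a * N)` is `φ^{⊠N}`.  Lagrange interpolation writes this coefficient as a linear combination of
more than `e * N` local transformations of `ψ^{⊠N}`, and a GHZ state with as many levels makes a single local
transformation of it (`SLOCC_of_degeneration`).  The pairs between the hub and the other parties
combine to a GHZ state with `d` levels (`IsHub.SLOCC_ghz`), so that `n * l` further copies of `ψ`
provide `d ^ l` levels.  It suffices that `l` is sublinear in `N`, for instance `l = e + 2 * √N`.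
-/

namespace MultiquditSLOCC

/-! ### SLOCC transformations and Kronecker products -/

section General

variable {n : ℕ} {U V W X : Fin n → Type}
  [∀ i, AddCommGroup (U i)] [∀ i, Module ℂ (U i)]
  [∀ i, AddCommGroup (V i)] [∀ i, Module ℂ (V i)]
  [∀ i, AddCommGroup (W i)] [∀ i, Module ℂ (W i)]
  [∀ i, AddCommGroup (X i)] [∀ i, Module ℂ (X i)]

theorem SLOCC.refl (ψ : ⨂[ℂ] i, U i) : SLOCC ψ ψ :=
  ⟨fun _ => LinearMap.id, by rw [PiTensorProduct.map_id]; rfl⟩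

theorem SLOCC.trans {ψ : ⨂[ℂ] i, U i} {φ : ⨂[ℂ] i, V i} {χ : ⨂[ℂ] i, W i}
    (h₁ : SLOCC ψ φ) (h₂ : SLOCC φ χ) : SLOCC ψ χ := by
  obtain ⟨A, rfl⟩ := h₁
  obtain ⟨B, rfl⟩ := h₂
  exact ⟨fun i => B i ∘ₗ A i, by rw [PiTensorProduct.map_comp]; rfl⟩

theorem kron_tprod (u : ∀ i, U i) (v : ∀ i, V i) :
    kron (PiTensorProduct.tprod ℂ u) (PiTensorProduct.tprod ℂ v) =
      PiTensorProduct.tprod ℂ (fun i => u i ⊗ₜ[ℂ] v i) := by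
  simp [kron, PiTensorProduct.map₂_tprod_tprod]

theorem kron_sum_smul_tprod {σ τ : Type} [Fintype σ] [Fintype τ] (c : σ → ℂ) (e : τ → ℂ)
    (u : σ → ∀ i, U i) (v : τ → ∀ i, V i) :
    kron (∑ s, c s • PiTensorProduct.tprod ℂ (u s)) (∑ t, e t • PiTensorProduct.tprod ℂ (v t)) =
      ∑ s, ∑ t, (c s * e t) • PiTensorProduct.tprod ℂ (fun i => u s i ⊗ₜ[ℂ] v t i) := by
  simp_rw [← kron_tprod, kron, map_sum, LinearMap.sum_apply, map_smul, LinearMap.smul_apply,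
    smul_smul]
  rw [Finset.sum_comm]
  simp_rw [mul_comm]

theorem map_kron (A : ∀ i, U i →ₗ[ℂ] W i) (B : ∀ i, V i →ₗ[ℂ] X i)
    (ψ : ⨂[ℂ] i, U i) (φ : ⨂[ℂ] i, V i) :
    PiTensorProduct.map (fun i => TensorProduct.map (A i) (B i)) (kron ψ φ) =
      kron (PiTensorProduct.map A ψ) (PiTensorProduct.map B φ) := by
  induction ψ using PiTensorProduct.induction_on with
  | smul_tprod r u =>
    induction φ using PiTensorProduct.induction_on with
    | smul_tprod s v =>
      have h := kron_tprod u v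
      have h' := kron_tprod (fun i => A i (u i)) (fun i => B i (v i))
      simp only [kron] at h h' ⊢
      simp [h, h']
    | add x y hx hy => simp only [kron, map_add] at hx hy ⊢; rw [hx, hy]
  | add x y hx hy =>
    simp only [kron, map_add, LinearMap.add_apply] at hx hy ⊢; rw [hx, hy]

theorem SLOCC.kron {ψ : ⨂[ℂ] i, U i} {φ : ⨂[ℂ] i, V i} {ψ' : ⨂[ℂ] i, W i} {φ' : ⨂[ℂ] i, X i}
    (h₁ : SLOCC ψ ψ') (h₂ : SLOCC φ φ') :
    SLOCC (MultiquditSLOCC.kron ψ φ) (MultiquditSLOCC.kron ψ' φ') := by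
  obtain ⟨A, rfl⟩ := h₁
  obtain ⟨B, rfl⟩ := h₂
  exact ⟨_, map_kron A B ψ φ⟩

/-! ### Kronecker powers of sums of product tensors -/

theorem appendFactor_tprod {M : Type} [AddCommGroup M] [Module ℂ M] (m : ℕ) (a : Fin m → M)
    (x : M) :
    appendFactor M m (PiTensorProduct.tprod ℂ a ⊗ₜ[ℂ] x) =
      PiTensorProduct.tprod ℂ (Fin.snoc a x : Fin (m + 1) → M) := by
  rw [appendFactor, LinearEquiv.trans_apply, TensorProduct.congr_tmul, LinearEquiv.refl_apply,
    PiTensorProduct.subsingletonEquiv_symm_apply']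
  refine (TensorPower.tprod_mul_tprod ℂ a (fun _ => x)).trans ?_
  rw [Fin.append_right_eq_snoc]

theorem kronPow_sum_smul_tprod {σ : Type} [Fintype σ] (c : σ → ℂ) (u : σ → ∀ i, U i) (m : ℕ) :
    kronPow (∑ s, c s • PiTensorProduct.tprod ℂ (u s)) m =
      ∑ f : Fin m → σ, (∏ t, c (f t)) •
        PiTensorProduct.tprod ℂ (fun i => PiTensorProduct.tprod ℂ (fun t => u (f t) i)) := by
  induction m with
  | zero =>
    simp only [kronPow, Fintype.sum_unique, Finset.univ_eq_empty, Finset.prod_empty, one_smul]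
    congr 1; funext i; congr 1; funext t; exact t.elim0
  | succ m ih =>
    rw [kronPow, ih, kron_sum_smul_tprod, ← (Fin.snocEquiv fun _ : Fin (m + 1) => σ).sum_comp,
      Fintype.sum_prod_type_right]
    simp_rw [map_sum]
    refine Finset.sum_congr rfl fun f _ => Finset.sum_congr rfl fun s _ => ?_
    rw [map_smul, PiTensorProduct.map_tprod]
    simp only [LinearEquiv.coe_coe, appendFactor_tprod, Fin.snocEquiv_apply]
    congr 1
    · rw [Fin.prod_univ_castSucc]; simp
    · congr 1; funext i; congr 1; funext t
      refine Fin.lastCases ?_ (fun t => ?_) t <;> simp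

theorem kronPow_sum_tprod {σ : Type} [Fintype σ] (u : σ → ∀ i, U i) (m : ℕ) :
    kronPow (∑ s, PiTensorProduct.tprod ℂ (u s)) m =
      ∑ f : Fin m → σ,
        PiTensorProduct.tprod ℂ (fun i => PiTensorProduct.tprod ℂ (fun t => u (f t) i)) := by
  simpa using kronPow_sum_smul_tprod (fun _ => (1 : ℂ)) u m

/-- `a + b` copies of a state are `a` copies together with `b` copies. -/
theorem SLOCC_kronPow_add {σ : Type} [Fintype σ] (u : σ → ∀ i, U i) (a b : ℕ) :
    SLOCC (kronPow (∑ s, PiTensorProduct.tprod ℂ (u s)) (a + b))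
      (kron (kronPow (∑ s, PiTensorProduct.tprod ℂ (u s)) a)
        (kronPow (∑ s, PiTensorProduct.tprod ℂ (u s)) b)) := by
  refine ⟨fun i => (TensorPower.mulEquiv (R := ℂ) (M := U i) (n := a) (m := b)).symm.toLinearMap,
    ?_⟩
  have key := kron_sum_smul_tprod (fun _ : Fin a → σ => (1 : ℂ)) (fun _ : Fin b → σ => (1 : ℂ))
    (fun f i => PiTensorProduct.tprod ℂ (fun t => u (f t) i))
    (fun f i => PiTensorProduct.tprod ℂ (fun t => u (f t) i))
  simp only [one_smul, mul_one] at key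
  simp_rw [kronPow_sum_tprod]
  rw [key, map_sum, ← (Fin.appendEquiv a b).sum_comp, Fintype.sum_prod_type]
  refine Finset.sum_congr rfl fun f _ => Finset.sum_congr rfl fun g _ => ?_
  rw [PiTensorProduct.map_tprod]
  congr 1; funext i
  rw [LinearEquiv.coe_coe, LinearEquiv.symm_apply_eq]
  refine Eq.trans ?_ (TensorPower.tprod_mul_tprod ℂ (fun t => u (f t) i)
    (fun t => u (g t) i)).symm
  congr 1; funext t
  refine Fin.addCases (fun t => ?_) (fun t => ?_) t <;> simp [Fin.appendEquiv]

end General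

/-! ### GHZ states -/

/-- The `n`-partite GHZ state `∑ₖ |k ⋯ k⟩` with levels indexed by `κ`. -/
noncomputable def ghz (n : ℕ) (κ : Type) [Fintype κ] [DecidableEq κ] :
    ⨂[ℂ] _ : Fin n, (κ → ℂ) :=
  ∑ k : κ, PiTensorProduct.tprod ℂ (fun _ => Pi.single k 1)

theorem SLOCC_kron_ghz_ghz (n : ℕ) (κ μ : Type) [Fintype κ] [DecidableEq κ] [Fintype μ]
    [DecidableEq μ] : SLOCC (kron (ghz n κ) (ghz n μ)) (ghz n (κ × μ)) := by
  let f : (κ → ℂ) →ₗ[ℂ] (μ → ℂ) →ₗ[ℂ] (κ × μ → ℂ) :=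
    LinearMap.mk₂ ℂ (fun x y p => x p.1 * y p.2)
      (fun _ _ _ => by funext p; simp [add_mul]) (fun _ _ _ => by funext p; simp [mul_assoc])
      (fun _ _ _ => by funext p; simp [mul_add])
      (fun _ _ _ => by funext p; simp [mul_left_comm])
  refine ⟨fun _ => TensorProduct.lift f, ?_⟩
  have key := kron_sum_smul_tprod (n := n) (fun _ : κ => (1 : ℂ)) (fun _ : μ => (1 : ℂ))
    (fun k _ => (Pi.single k 1 : κ → ℂ)) (fun k _ => (Pi.single k 1 : μ → ℂ))
  simp only [one_smul, mul_one] at key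
  rw [ghz, ghz, ghz, key, map_sum, Fintype.sum_prod_type]
  refine Finset.sum_congr rfl fun k _ => ?_
  rw [map_sum]
  refine Finset.sum_congr rfl fun l _ => ?_
  rw [PiTensorProduct.map_tprod]
  congr 1; funext i; funext p
  rcases p with ⟨p, q⟩
  by_cases hp : p = k <;> by_cases hq : q = l <;> simp [f, hp, hq]

section General

variable {n : ℕ} {U V : Fin n → Type}
  [∀ i, AddCommGroup (U i)] [∀ i, Module ℂ (U i)]
  [∀ i, AddCommGroup (V i)] [∀ i, Module ℂ (V i)]

theorem SLOCC_kron_ghz (κ : Type) [Fintype κ] [DecidableEq κ] (ψ : ⨂[ℂ] i, U i)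
    (A : κ → ∀ i, U i →ₗ[ℂ] V i) :
    SLOCC (kron ψ (ghz n κ)) (∑ k, PiTensorProduct.map (A k) ψ) := by
  let f : ∀ i, U i →ₗ[ℂ] (κ → ℂ) →ₗ[ℂ] V i := fun i =>
    LinearMap.mk₂ ℂ (fun x y => ∑ k, y k • A k i x)
      (fun _ _ _ => by simp [Finset.sum_add_distrib])
      (fun c x y => by
        rw [Finset.smul_sum]
        exact Finset.sum_congr rfl fun k _ => by rw [map_smul, smul_comm])
      (fun _ _ _ => by simp [Finset.sum_add_distrib, add_smul])
      (fun _ _ _ => by simp [Finset.smul_sum, mul_smul])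
  refine ⟨fun i => TensorProduct.lift (f i), ?_⟩
  induction ψ using PiTensorProduct.induction_on with
  | smul_tprod r u =>
    have key := kron_sum_smul_tprod (fun _ : Unit => r) (fun _ : κ => (1 : ℂ))
      (fun _ => u) (fun k _ => (Pi.single k 1 : κ → ℂ))
    simp only [one_smul, mul_one, Fintype.sum_unique] at key
    rw [ghz, key, map_sum]
    refine Finset.sum_congr rfl fun k _ => ?_
    rw [map_smul, map_smul, PiTensorProduct.map_tprod, PiTensorProduct.map_tprod]
    congr 2; funext i
    simp [f, Pi.single_apply]
  | add x y hx hy =>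
    have h : kron (x + y) (ghz n κ) = kron x (ghz n κ) + kron y (ghz n κ) := by
      simp [kron]
    rw [h, map_add, hx, hy, ← Finset.sum_add_distrib]
    simp

/-- A GHZ state turns a linear combination of local transformations into a single one; the
coefficients are absorbed by the operators of the party `i₀`. -/
theorem SLOCC_kron_ghz_smul (κ : Type) [Fintype κ] [DecidableEq κ] (i₀ : Fin n)
    (ψ : ⨂[ℂ] i, U i) (c : κ → ℂ) (A : κ → ∀ i, U i →ₗ[ℂ] V i) :
    SLOCC (kron ψ (ghz n κ)) (∑ k, c k • PiTensorProduct.map (A k) ψ) := by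
  have h := SLOCC_kron_ghz κ ψ (fun k => Function.update (A k) i₀ (c k • A k i₀))
  simpa only [PiTensorProduct.map_update_smul, Function.update_eq_self, LinearMap.smul_apply]
    using h

/-! ### Degenerations -/

/-- Coefficient extraction by Lagrange interpolation. -/
theorem exists_sum_mul_pow_eq_ite (κ : Type) [Fintype κ] [DecidableEq κ] (b : ℕ) :
    ∃ c z : κ → ℂ, ∀ W < Fintype.card κ, ∑ k, c k * z k ^ W = if W = b then 1 else 0 := by
  let z : κ → ℂ := fun k => ((Fintype.equivFin κ k : ℕ) : ℂ)
  have hz : Function.Injective z := fun k l h =>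
    (Fintype.equivFin κ).injective (Fin.ext (Nat.cast_injective h))
  refine ⟨fun k => (Lagrange.basis Finset.univ z k).coeff b, z, fun W hW => ?_⟩
  have h := Lagrange.eq_interpolate (s := Finset.univ) (v := z) hz.injOn
    (f := (Polynomial.X : Polynomial ℂ) ^ W) (by simpa using hW)
  have h' := congrArg (fun p => Polynomial.coeff p b) h
  simp only [Lagrange.interpolate_apply, Polynomial.finsetSum_coeff, Polynomial.coeff_C_mul,
    Polynomial.coeff_X_pow, Polynomial.eval_pow, Polynomial.eval_X] at h'
  simp only [mul_comm (Polynomial.coeff _ _)]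
  rw [← h']
  simp [eq_comm]

/-- If the local operators `D z` scale the product terms of `ψ` by powers of `z`, then `N` copies
of the part of `ψ` of lowest total degree `a` are obtained from `N` copies of `ψ` and a GHZ state
with more than `e * N` levels, `e` bounding all total degrees.  Indeed
`(D z ψ)^{⊠N}` is a polynomial in `z` of degree at most `e * N`, and the wanted state is its
coefficient at `z ^ (a * N)`. -/
theorem SLOCC_of_degeneration {σ : Type} [Fintype σ] (κ : Type) [Fintype κ] [DecidableEq κ]
    (i₀ : Fin n) (u : σ → ∀ i, U i) (w : σ → Fin n → ℕ) (D : ℂ → ∀ i, U i →ₗ[ℂ] U i)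
    (hD : ∀ z s i, D z i (u s i) = z ^ w s i • u s i) (a e N : ℕ)
    (ha : ∀ s, a ≤ ∑ i, w s i) (he : ∀ s, ∑ i, w s i ≤ e) (hκ : e * N < Fintype.card κ) :
    SLOCC (kron (kronPow (∑ s, PiTensorProduct.tprod ℂ (u s)) N) (ghz n κ))
      (kronPow (∑ s, (if ∑ i, w s i = a then (1 : ℂ) else 0) • PiTensorProduct.tprod ℂ (u s))
        N) := by
  obtain ⟨c, z, hcz⟩ := exists_sum_mul_pow_eq_ite κ (a * N)
  have h := SLOCC_kron_ghz_smul κ i₀ (kronPow (∑ s, PiTensorProduct.tprod ℂ (u s)) N) c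
    (fun k i => PiTensorProduct.map (fun _ : Fin N => D (z k) i))
  convert h using 1
  rw [kronPow_sum_smul_tprod, kronPow_sum_tprod]
  simp_rw [map_sum, PiTensorProduct.map_tprod, hD, MultilinearMap.map_smul_univ,
    Finset.smul_sum, smul_smul]
  rw [Finset.sum_comm]
  refine Finset.sum_congr rfl fun f _ => ?_
  rw [← Finset.sum_smul]
  congr 1
  have hpow : ∀ k, (∏ i, ∏ t, z k ^ w (f t) i) = z k ^ ∑ t, ∑ i, w (f t) i := fun k => by
    rw [Finset.prod_comm]
    exact (Finset.prod_congr rfl fun t _ => Finset.prod_pow_eq_pow_sum _ _ _).trans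
      (Finset.prod_pow_eq_pow_sum _ _ _)
  simp_rw [hpow]
  have hle : ∑ t, ∑ i, w (f t) i ≤ e * N := by
    simpa [mul_comm] using Finset.sum_le_sum fun t (_ : t ∈ Finset.univ) => he (f t)
  rw [hcz _ (hle.trans_lt hκ), Finset.prod_ite_zero, Finset.prod_const_one]
  have hiff : (∀ t ∈ Finset.univ, ∑ i, w (f t) i = a) ↔ ∑ t, ∑ i, w (f t) i = a * N := by
    have h₀ := Finset.sum_eq_sum_iff_of_le (s := Finset.univ)
      fun (t : Fin N) _ => ha (f t)
    rw [Finset.sum_const, Finset.card_univ, Fintype.card_fin, smul_eq_mul, mul_comm N a] at h₀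
    exact ⟨fun h => (h₀.2 fun t ht => (h t ht).symm).symm, fun h t ht => (h₀.1 h.symm t ht).symm⟩
  simp only [hiff]

/-! ### Product functionals and conciseness -/

/-- The product functional `⨂ xᵢ ↦ ∏ αᵢ xᵢ` on a tensor product of finitely many spaces. -/
noncomputable def prodFunctional {ι : Type} [Fintype ι] {M : ι → Type}
    [∀ i, AddCommGroup (M i)] [∀ i, Module ℂ (M i)] (α : ∀ i, M i →ₗ[ℂ] ℂ) :
    (⨂[ℂ] i, M i) →ₗ[ℂ] ℂ :=
  PiTensorProduct.lift ((MultilinearMap.mkPiAlgebra ℂ ι ℂ).compLinearMap α)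

@[simp]
theorem prodFunctional_tprod {ι : Type} [Fintype ι] {M : ι → Type}
    [∀ i, AddCommGroup (M i)] [∀ i, Module ℂ (M i)] (α : ∀ i, M i →ₗ[ℂ] ℂ) (x : ∀ i, M i) :
    prodFunctional α (PiTensorProduct.tprod ℂ x) = ∏ i, α i (x i) := by
  simp [prodFunctional]

theorem prodFunctional_map (α : ∀ i, V i →ₗ[ℂ] ℂ) (A : ∀ i, U i →ₗ[ℂ] V i) (ψ : ⨂[ℂ] i, U i) :
    prodFunctional α (PiTensorProduct.map A ψ) = prodFunctional (fun i => α i ∘ₗ A i) ψ := by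
  induction ψ using PiTensorProduct.induction_on with
  | smul_tprod r u => simp
  | add x y hx hy => rw [map_add, map_add, map_add, hx, hy]

theorem prodFunctional_eq_zero (α : ∀ i, U i →ₗ[ℂ] ℂ) {i₀ : Fin n} (h : α i₀ = 0)
    (ψ : ⨂[ℂ] i, U i) : prodFunctional α ψ = 0 := by
  induction ψ using PiTensorProduct.induction_on with
  | smul_tprod r u =>
    rw [map_smul, prodFunctional_tprod, Finset.prod_eq_zero (Finset.mem_univ i₀), smul_zero]
    rw [h]; rfl
  | add x y hx hy => rw [map_add, hx, hy, add_zero]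

theorem finrank_tensorPower (M : Type) [AddCommGroup M] [Module ℂ M] [Module.Finite ℂ M] (m : ℕ) :
    Module.finrank ℂ (⨂[ℂ]^m M) = Module.finrank ℂ M ^ m := by
  rw [Module.finrank_eq_card_basis
    (Basis.piTensorProduct fun _ : Fin m => Module.finBasis ℂ M)]
  simp

/-- Suppose that every vector of the party `i₀` is obtained from `φ = ∑ₛ ⨂ᵢ v s i` by applying
functionals at the other parties.  Then the powers of `φ` have the same property, so that a
transformation of `ψ^{⊠m}` into `φ^{⊠N}` acts by a surjection at `i₀`. -/
theorem finrank_pow_le_of_SLOCC {τ : Type} [Fintype τ] (v : τ → ∀ i, V i)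
    (i₀ : Fin n) [Module.Finite ℂ (U i₀)] [Module.Finite ℂ (V i₀)]
    (hv : ∀ x : V i₀, ∃ α : ∀ i, V i →ₗ[ℂ] ℂ,
      ∑ s, (∏ i ∈ Finset.univ.erase i₀, α i (v s i)) • v s i₀ = x)
    (ψ : ⨂[ℂ] i, U i) (m N : ℕ)
    (h : SLOCC (kronPow ψ m) (kronPow (∑ s, PiTensorProduct.tprod ℂ (v s)) N)) :
    Module.finrank ℂ (V i₀) ^ N ≤ Module.finrank ℂ (U i₀) ^ m := by
  obtain ⟨A, hA⟩ := h
  rw [← finrank_tensorPower, ← finrank_tensorPower]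
  have : Module.Finite ℂ (⨂[ℂ]^m (U i₀)) :=
    Module.Finite.of_basis (Basis.piTensorProduct fun _ : Fin m => Module.finBasis ℂ (U i₀))
  refine LinearMap.finrank_le_finrank_of_surjective (f := A i₀) ?_
  rw [← LinearMap.range_eq_top]
  by_contra hne
  -- A functional `l` that vanishes on the range of `A i₀` vanishes on all product tensors.
  obtain ⟨l, hl, hlA⟩ := Submodule.exists_le_ker_of_lt_top _ (lt_top_iff_ne_top.2 hne)
  have hlA' : l ∘ₗ A i₀ = 0 := LinearMap.ext fun x => hlA ⟨x, rfl⟩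
  apply hl
  refine PiTensorProduct.ext (MultilinearMap.ext fun x => ?_)
  choose α hα using fun t => hv (x t)
  -- The functional which is `l` at `i₀` and contracts the copies separately elsewhere.
  let β : ∀ i, (⨂[ℂ]^N (V i)) →ₗ[ℂ] ℂ :=
    Function.update (fun i => prodFunctional fun t => α t i) i₀ l
  have h0 : prodFunctional β (kronPow (∑ s, PiTensorProduct.tprod ℂ (v s)) N) = 0 := by
    rw [← hA, prodFunctional_map]
    exact prodFunctional_eq_zero (i₀ := i₀) _ (by simp [β, hlA']) _
  rw [kronPow_sum_tprod, map_sum] at h0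
  have hx : PiTensorProduct.tprod ℂ x = ∑ f : Fin N → τ,
      (∏ t, ∏ i ∈ Finset.univ.erase i₀, α t i (v (f t) i)) •
        PiTensorProduct.tprod ℂ (fun t => v (f t) i₀) := by
    simp_rw [← MultilinearMap.map_smul_univ]
    refine Eq.trans ?_ (MultilinearMap.map_sum (PiTensorProduct.tprod ℂ) fun (t : Fin N) (s : τ) =>
      (∏ i ∈ Finset.univ.erase i₀, α t i (v s i)) • v s i₀)
    congr 1; funext t; exact (hα t).symm
  simp only [LinearMap.compMultilinearMap_apply, LinearMap.zero_apply]
  rw [hx, map_sum, ← h0]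
  refine Finset.sum_congr rfl fun f _ => ?_
  rw [prodFunctional_tprod, ← Finset.mul_prod_erase _ _ (Finset.mem_univ i₀), map_smul,
    smul_eq_mul, mul_comm, Finset.prod_comm]
  congr 1
  · simp [β]
  · refine Finset.prod_congr rfl fun i hi => ?_
    simp [β, Function.update_of_ne (Finset.ne_of_mem_erase hi)]

end General

/-! ### States supported on a set of basis vectors -/

section Support

variable {d n : ℕ}

/-- The state `∑_{J ∈ S} |J₁ ⋯ Jₙ⟩`. -/
noncomputable def supportState (d : ℕ) (S : Finset (Fin n → ℕ)) : Qudits d n := ∑ J ∈ S, kets d J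

theorem supportState_eq_sum_tprod (S : Finset (Fin n → ℕ)) :
    supportState d S = ∑ J : S, PiTensorProduct.tprod ℂ (fun i => ket d (J.1 i)) :=
  (Finset.sum_coe_sort S (kets d)).symm

/-- The party `h` is a hub of the set `S` of labels: all labels in `S` have total `d - 1`, and
projecting all parties but `h` and any other one onto `|0⟩` leaves a maximally entangled pair
`∑ⱼ |j⟩|d-1-j⟩`. -/
structure IsHub (d : ℕ) (S : Finset (Fin n → ℕ)) (h : Fin n) : Prop where
  sum_eq : ∀ J ∈ S, ∑ i, J i = d - 1
  mem : ∀ i ≠ h, ∀ j ≤ d - 1, (Pi.single i j + Pi.single h (d - 1 - j) : Fin n → ℕ) ∈ S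

/-- The functional `⟨j|` on `ℂ^d`, which is zero for `j ≥ d`. -/
noncomputable def bra (d j : ℕ) : (Fin d → ℂ) →ₗ[ℂ] ℂ :=
  if h : j < d then LinearMap.proj ⟨j, h⟩ else 0

theorem bra_ket {j : ℕ} (h : j < d) (k : ℕ) : bra d j (ket d k) = if j = k then 1 else 0 := by
  simp [bra, ket, h]

theorem tprod_eq_sum_single {κ : Type} [Fintype κ] [DecidableEq κ] (x : Fin n → κ → ℂ) :
    PiTensorProduct.tprod ℂ x =
      ∑ q : Fin n → κ, (∏ p, x p (q p)) •
        PiTensorProduct.tprod ℂ (fun p => (Pi.single (q p) 1 : κ → ℂ)) := by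
  simp_rw [← MultilinearMap.map_smul_univ]
  refine Eq.trans ?_ (MultilinearMap.map_sum (PiTensorProduct.tprod ℂ) fun (p : Fin n) (k : κ) =>
    x p k • (Pi.single k 1 : κ → ℂ))
  congr 1; funext p
  exact pi_eq_sum_univ' (x p)

/-- The label which the copy number `t` is projected onto when the parties are to output the levels
`q`: a copy `t ≠ h` is used as a pair of the parties `t` and `h`, and the copy number `h`
is discarded by projecting it onto `|0 ⋯ (d-1) ⋯ 0⟩`, with `d - 1` at the party `h`.  The entry of
the party `p` depends only on its own output `q p`. -/
def pairLabel (d : ℕ) (h p t : Fin n) (k : ℕ) : ℕ :=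
  if t = h then (if p = h then d - 1 else 0)
  else if p = h then d - 1 - k else if p = t then k else 0

theorem pairLabel_lt (h p t : Fin n) {k : ℕ} (hk : k < d) : pairLabel d h p t k < d := by
  unfold pairLabel; split_ifs <;> omega

theorem pairLabel_mem_iff {S : Finset (Fin n → ℕ)} {h : Fin n} (hS : IsHub d S h)
    (hn : ∃ p, p ≠ h) (q : Fin n → Fin d) (t : Fin n) :
    (fun p => pairLabel d h p t (q p)) ∈ S ↔ q t = q h := by
  have hqh := (q h).isLt
  have hqt := (q t).isLt
  by_cases ht : t = h
  · subst ht
    obtain ⟨p, hp⟩ := hn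
    have := hS.mem p hp 0 (Nat.zero_le _)
    simp only [iff_true]
    convert this using 1
    funext r
    by_cases hr : r = t <;> simp [pairLabel, hr]
  · have heq : (fun p => pairLabel d h p t (q p)) =
        (Pi.single t (q t : ℕ) + Pi.single h (d - 1 - (q h : ℕ)) : Fin n → ℕ) := by
      funext r
      by_cases hr : r = h
      · subst hr; simp [pairLabel, ht]
      · by_cases hrt : r = t
        · subst hrt; simp [pairLabel, ht]
        · simp [pairLabel, hr, hrt, ht]
    rw [heq]
    constructor
    · intro hmem
      have hsum := hS.sum_eq _ hmem
      simp only [Pi.add_apply, Finset.sum_add_distrib, Finset.sum_pi_single', Finset.mem_univ,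
        if_true] at hsum
      exact Fin.ext (by omega)
    · intro hq
      rw [← hq]
      exact hS.mem t ht _ (by omega)

/-- The maximally entangled pairs of the hub with each of the other parties combine to a GHZ
state of all parties. -/
theorem IsHub.SLOCC_ghz {S : Finset (Fin n → ℕ)} {h : Fin n} (hS : IsHub d S h)
    (hn : ∃ p, p ≠ h) : SLOCC (kronPow (supportState d S) n) (ghz n (Fin d)) := by
  refine ⟨fun p => LinearMap.pi fun k => prodFunctional fun t : Fin n =>
    bra d (pairLabel d h p t (k : ℕ)), ?_⟩
  rw [supportState_eq_sum_tprod, kronPow_sum_tprod, map_sum]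
  simp_rw [PiTensorProduct.map_tprod]
  rw [Finset.sum_congr rfl fun f _ => tprod_eq_sum_single _, Finset.sum_comm, ghz]
  simp only [LinearMap.pi_apply, prodFunctional_tprod, ← Finset.sum_smul]
  -- The coefficient of `|q⟩` factors over the copies, and the copy `t` contributes 1 or 0 according
  -- to whether `q t = q h`; so exactly the constant `q` survive.
  have hcoeff : ∀ q : Fin n → Fin d,
      ∑ f : Fin n → S, ∏ p, ∏ t, bra d (pairLabel d h p t (q p)) (ket d ((f t).1 p)) =
        ∑ k, if q = fun _ => k then (1 : ℂ) else 0 := fun q => by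
    have h1 : ∀ f : Fin n → S,
        ∏ p, ∏ t, bra d (pairLabel d h p t (q p)) (ket d ((f t).1 p)) =
          ∏ t, if (fun p => pairLabel d h p t (q p)) = (f t).1 then (1 : ℂ) else 0 := fun f => by
      rw [Finset.prod_comm]
      refine Finset.prod_congr rfl fun t _ => ?_
      simp_rw [bra_ket (pairLabel_lt h _ t (q _).isLt)]
      rw [Finset.prod_ite_zero]
      simp [funext_iff]
    have h2 : ∀ t, (∑ J : S, if (fun p => pairLabel d h p t (q p)) = J.1 then (1 : ℂ) else 0) =
        if q t = q h then 1 else 0 := fun t => by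
      rw [Finset.sum_coe_sort S fun J => if (fun p => pairLabel d h p t (q p)) = J then (1 : ℂ)
        else 0, Finset.sum_ite_eq]
      simp only [pairLabel_mem_iff hS hn]
    simp_rw [h1]
    have h3 := Finset.prod_univ_sum (fun _ : Fin n => (Finset.univ : Finset S))
      (fun t J => if (fun p => pairLabel d h p t (q p)) = J.1 then (1 : ℂ) else 0)
    rw [Fintype.piFinset_univ] at h3
    rw [← h3]
    simp_rw [h2]
    rw [Finset.prod_ite_zero, Finset.prod_const_one]
    simp only [funext_iff]
    by_cases hq : ∀ t, q t = q h
    · rw [if_pos fun t _ => hq t, Finset.sum_eq_single (q h), if_pos hq]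
      · intro k _ hk
        exact if_neg fun hk' => hk (hk' h).symm
      · simp
    · rw [if_neg fun h' => hq fun t => h' t (Finset.mem_univ t), Finset.sum_eq_zero]
      intro k _
      exact if_neg fun hk' => hq fun t => (hk' t).trans (hk' h).symm
  simp_rw [hcoeff, Finset.sum_smul]
  rw [Finset.sum_comm]
  simp

/-- `n * l` copies of a state with a hub provide a GHZ state with `d ^ l` levels. -/
theorem IsHub.exists_ghz {S : Finset (Fin n → ℕ)} {h : Fin n} (hS : IsHub d S h)
    (hn : ∃ p, p ≠ h) (l : ℕ) : ∃ (κ : Type) (_ : Fintype κ) (_ : DecidableEq κ),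
      Fintype.card κ = d ^ l ∧ SLOCC (kronPow (supportState d S) (n * l)) (ghz n κ) := by
  induction l with
  | zero =>
    refine ⟨Unit, inferInstance, inferInstance, by simp, ?_⟩
    change SLOCC (kronPow (supportState d S) 0) _
    refine ⟨fun _ => PiTensorProduct.lift (MultilinearMap.constOfIsEmpty ℂ _ (Pi.single () 1)), ?_⟩
    simp [kronPow, ghz]
  | succ l ih =>
    obtain ⟨κ, _, _, hκ, hl⟩ := ih
    refine ⟨κ × Fin d, inferInstance, inferInstance, by simp [hκ, pow_succ], ?_⟩
    have hadd := SLOCC_kronPow_add (fun J : S => fun i => ket d (J.1 i)) (n * l) n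
    rw [← supportState_eq_sum_tprod] at hadd
    exact (hadd.trans (hl.kron (hS.SLOCC_ghz hn))).trans (SLOCC_kron_ghz_ghz n κ (Fin d))

/-- A state with a hub is concise there: contracting a party `p ≠ h` with `∑ⱼ xⱼ ⟨d-1-j|` and the
others with `⟨0|` leaves the vector `x` at `h`. -/
theorem IsHub.exists_contraction {S : Finset (Fin n → ℕ)} {h : Fin n} (hS : IsHub d S h)
    (hn : ∃ p, p ≠ h) (x : Fin d → ℂ) : ∃ α : Fin n → (Fin d → ℂ) →ₗ[ℂ] ℂ,
      ∑ J : S, (∏ i ∈ Finset.univ.erase h, α i (ket d (J.1 i))) • ket d (J.1 h) = x := by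
  obtain ⟨p, hp⟩ := hn
  let β : (Fin d → ℂ) →ₗ[ℂ] ℂ := ∑ j : Fin d, x j • bra d (d - 1 - j)
  refine ⟨fun i => if i = p then β else bra d 0, ?_⟩
  funext k
  have hk := k.isLt
  rw [Finset.sum_coe_sort S fun J => (∏ i ∈ Finset.univ.erase h,
    (if i = p then β else bra d 0) (ket d (J i))) • ket d (J h), Finset.sum_apply]
  have hmem := hS.mem p hp (d - 1 - k) (by omega)
  have hk' : d - 1 - (d - 1 - (k : ℕ)) = k := by omega
  rw [hk'] at hmem
  have hβ : ∀ j, β (ket d j) = ∑ l : Fin d, if d - 1 - (l : ℕ) = j then x l else 0 := fun j => by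
    simp only [β, LinearMap.sum_apply, LinearMap.smul_apply, smul_eq_mul]
    refine Finset.sum_congr rfl fun l _ => ?_
    rw [bra_ket (by omega)]; simp
  rw [Finset.sum_eq_single_of_mem _ hmem]
  · have h1 : ∀ i ∈ (Finset.univ.erase h).erase p, (if i = p then β else bra d 0)
        (ket d ((Pi.single p (d - 1 - (k : ℕ)) + Pi.single h (k : ℕ) : Fin n → ℕ) i)) = 1 := by
      intro i hi
      simp only [Finset.mem_erase, Finset.mem_univ, and_true] at hi
      rw [if_neg hi.1, bra_ket (by omega)]
      simp [hi.1, hi.2]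
    rw [Pi.smul_apply, ← Finset.mul_prod_erase _ _ (Finset.mem_erase.2 ⟨hp, Finset.mem_univ p⟩),
      Finset.prod_congr rfl h1, if_pos rfl, hβ]
    rw [Finset.sum_eq_single_of_mem k (Finset.mem_univ k)]
    · simp [ket, Pi.single_eq_of_ne hp, Pi.single_eq_of_ne' hp]
    · intro l _ hl
      refine if_neg fun hl' => hl (Fin.ext ?_)
      simp only [Pi.add_apply, Pi.single_eq_same, Pi.single_eq_of_ne hp] at hl'
      omega
  -- A label that contributes has entry `k` at `h` and entries 0 off `p` and `h`, hence, by its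
  -- total, the entry `d - 1 - k` at `p`.
  · intro J hJ hne
    by_contra h0
    rw [Pi.smul_apply, smul_eq_mul] at h0
    obtain ⟨h1, h2⟩ := mul_ne_zero_iff.1 h0
    have hJh : J h = k := by
      by_contra hJh
      exact h2 (by simp [ket, Ne.symm hJh])
    have hJi : ∀ i, i ≠ h → i ≠ p → J i = 0 := by
      intro i hih hip
      have := Finset.prod_ne_zero_iff.1 h1 i (Finset.mem_erase.2 ⟨hih, Finset.mem_univ i⟩)
      rw [if_neg hip, bra_ket (by omega)] at this
      by_contra hJi
      exact this (if_neg (Ne.symm hJi))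
    have hsum := hS.sum_eq J hJ
    rw [← Finset.add_sum_erase _ _ (Finset.mem_univ h), ← Finset.add_sum_erase _ _
      (Finset.mem_erase.2 ⟨hp, Finset.mem_univ p⟩), Finset.sum_eq_zero, add_zero] at hsum
    · refine hne (funext fun i => ?_)
      by_cases hih : i = h
      · subst hih; simp [hJh, Pi.single_eq_of_ne' hp]
      · by_cases hip : i = p
        · subst hip; simp [Pi.single_eq_of_ne hp]; omega
        · simp [hih, hip, hJi i hih hip]
    · intro i hi
      simp only [Finset.mem_erase, Finset.mem_univ, and_true] at hi
      exact hJi i hi.2 hi.1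

/-! ### Rates between degenerations -/

theorem IsHub.le_of_SLOCC (hd : 2 ≤ d) {S' : Finset (Fin n → ℕ)} {h : Fin n} (hS' : IsHub d S' h)
    (hn : ∃ p, p ≠ h) (ψ : Qudits d n) {m N : ℕ}
    (hmN : SLOCC (kronPow ψ m) (kronPow (supportState d S') N)) : N ≤ m := by
  rw [supportState_eq_sum_tprod] at hmN
  have := finrank_pow_le_of_SLOCC (fun J : S' => fun i => ket d (J.1 i)) h
    (hS'.exists_contraction hn) ψ m N hmN
  rw [Module.finrank_fin_fun] at this
  exact (Nat.pow_le_pow_iff_right hd).1 this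

/-- Degenerations can be carried out with a number of extra copies of `ψ` that is logarithmic in
the number of copies. -/
theorem IsHub.SLOCC_of_weight {S S' : Finset (Fin n → ℕ)} {h : Fin n} (hS : IsHub d S h)
    (hn : ∃ p, p ≠ h) (hSS' : S' ⊆ S) (w : Fin n → ℕ → ℕ) (a e : ℕ)
    (ha : ∀ J ∈ S, a ≤ ∑ i, w i (J i)) (he : ∀ J ∈ S, ∑ i, w i (J i) ≤ e)
    (haS' : ∀ J ∈ S, ∑ i, w i (J i) = a ↔ J ∈ S') (N l : ℕ) (hl : e * N < d ^ l) :
    SLOCC (kronPow (supportState d S) (N + n * l)) (kronPow (supportState d S') N) := by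
  obtain ⟨κ, _, _, hκ, hghz⟩ := hS.exists_ghz hn l
  have hadd := SLOCC_kronPow_add (fun J : S => fun i => ket d (J.1 i)) N (n * l)
  rw [← supportState_eq_sum_tprod] at hadd
  refine (hadd.trans ((SLOCC.refl _).kron hghz)).trans ?_
  let D : ℂ → Fin n → (Fin d → ℂ) →ₗ[ℂ] (Fin d → ℂ) := fun z i =>
    LinearMap.pi fun k => z ^ w i k • LinearMap.proj k
  have hD : ∀ z (J : S) i, D z i (ket d (J.1 i)) = z ^ w i (J.1 i) • ket d (J.1 i) := by
    intro z J i
    funext k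
    by_cases hk : (k : ℕ) = J.1 i <;> simp [D, ket, hk]
  have key := SLOCC_of_degeneration κ h (fun J : S => fun i => ket d (J.1 i))
    (fun J i => w i (J.1 i)) D hD a e N (fun J => ha J.1 J.2) (fun J => he J.1 J.2)
    (by rwa [hκ])
  rw [← supportState_eq_sum_tprod] at key
  convert key using 2
  rw [Finset.sum_coe_sort S fun J => (if ∑ i, w i (J i) = a then (1 : ℂ) else 0) •
    PiTensorProduct.tprod ℂ (fun i => ket d (J i))]
  simp only [ite_smul, one_smul, zero_smul]
  rw [← Finset.sum_filter, supportState]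
  refine Finset.sum_congr ?_ fun _ _ => rfl
  ext J
  rw [Finset.mem_filter]
  exact ⟨fun hJ => ⟨hSS' hJ, (haS' J (hSS' hJ)).2 hJ⟩, fun hJ => (haS' J hJ.1).1 hJ.2⟩

/-- The number `e + 2 * √N` of blocks of extra copies is large enough for the interpolation. -/
theorem mul_lt_two_pow (e N : ℕ) : e * N < 2 ^ (e + 2 * Nat.sqrt N) := by
  have h1 : N < (2 ^ Nat.sqrt N) * (2 ^ Nat.sqrt N) :=
    (Nat.lt_succ_sqrt N).trans_le (Nat.mul_le_mul Nat.lt_two_pow_self Nat.lt_two_pow_self)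
  rw [pow_add, two_mul, pow_add]
  exact Nat.mul_lt_mul'' Nat.lt_two_pow_self h1

open Filter Topology ENNReal in
theorem tendsto_one_of_sqrt_bound {c : ℕ → ℝ≥0∞} (n e : ℕ) (hlow : ∀ N : ℕ, (N : ℝ≥0∞) ≤ c N)
    (hup : ∀ N : ℕ, c N ≤ ((N + n * (e + 2 * Nat.sqrt N) : ℕ) : ℝ≥0∞)) :
    Tendsto (fun N : ℕ => c N / (N : ℝ≥0∞)) atTop (𝓝 1) := by
  have hreal : Tendsto (fun N : ℕ => 1 + (n * e : ℝ) * (N : ℝ)⁻¹ +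
      (2 * n : ℝ) * (Real.sqrt N)⁻¹) atTop (𝓝 1) := by
    have h1 : Tendsto (fun N : ℕ => (N : ℝ)⁻¹) atTop (𝓝 0) := tendsto_inv_atTop_nhds_zero_nat
    have h2 : Tendsto (fun N : ℕ => (Real.sqrt N)⁻¹) atTop (𝓝 0) :=
      tendsto_inv_atTop_zero.comp (Real.tendsto_sqrt_atTop.comp tendsto_natCast_atTop_atTop)
    simpa using ((h1.const_mul (n * e : ℝ)).const_add 1).add (h2.const_mul (2 * n : ℝ))
  have hlim := ENNReal.tendsto_ofReal hreal
  rw [ENNReal.ofReal_one] at hlim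
  refine tendsto_of_tendsto_of_tendsto_of_le_of_le' tendsto_const_nhds hlim ?_ ?_
  · filter_upwards [eventually_gt_atTop 0] with N hN
    rw [ENNReal.le_div_iff_mul_le (Or.inl (by simpa using hN.ne')) (Or.inl (by simp)), one_mul]
    exact hlow N
  · filter_upwards [eventually_gt_atTop 0] with N hN
    have hN' : (0 : ℝ) < N := by exact_mod_cast hN
    refine ENNReal.div_le_of_le_mul ((hup N).trans ?_)
    rw [← ENNReal.ofReal_natCast, ← ENNReal.ofReal_natCast, ← ENNReal.ofReal_mul (by positivity)]
    refine ENNReal.ofReal_le_ofReal ?_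
    have hs : (Nat.sqrt N : ℝ) ≤ Real.sqrt N := Real.nat_sqrt_le_real_sqrt
    have hs' : (Real.sqrt N)⁻¹ * N = Real.sqrt N := by
      rw [inv_mul_eq_div, Real.div_sqrt]
    have hn0 : (0 : ℝ) ≤ 2 * n := by positivity
    have := mul_le_mul_of_nonneg_left hs hn0
    rw [add_mul, add_mul, mul_assoc (2 * n : ℝ), hs', mul_assoc (n * e : ℝ),
      inv_mul_cancel₀ hN'.ne']
    push_cast
    linarith

theorem IsHub.hasSLOCCRate_one (hd : 2 ≤ d) {S S' : Finset (Fin n → ℕ)} {h : Fin n}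
    (hS : IsHub d S h) (hS' : IsHub d S' h) (hn : ∃ p, p ≠ h) (hSS' : S' ⊆ S)
    (w : Fin n → ℕ → ℕ) (a : ℕ) (ha : ∀ J ∈ S, a ≤ ∑ i, w i (J i))
    (haS' : ∀ J ∈ S, ∑ i, w i (J i) = a ↔ J ∈ S') :
    HasSLOCCRate (supportState d S) (supportState d S') 1 := by
  let e := S.sup fun J => ∑ i, w i (J i)
  refine tendsto_one_of_sqrt_bound n e (fun N => ?_) (fun N => ?_)
  · refine le_iInf₂ fun m hm => ?_
    exact_mod_cast hS'.le_of_SLOCC hd hn _ hm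
  · refine iInf₂_le (N + n * (e + 2 * Nat.sqrt N)) ?_
    exact hS.SLOCC_of_weight hn hSS' w a e ha
      (fun J hJ => Finset.le_sup (f := fun J => ∑ i, w i (J i)) hJ) haS' N _
      ((mul_lt_two_pow e N).trans_le (Nat.pow_le_pow_left hd _))

end Support

/-! ### The labels of the three states -/

section Labels

variable {d n : ℕ}

theorem eq_single_add_single {J : Fin n → ℕ} {D : ℕ} (hJ : ∑ i, J i = D) {x y : Fin n}
    (hxy : x ≠ y) (h : ∀ i, i ≠ x → i ≠ y → J i = 0) :
    J = Pi.single x (J x) + Pi.single y (D - J x) := by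
  have hy : J x + J y = D := by
    rw [← hJ, ← Finset.sum_pair hxy]
    exact Finset.sum_subset (Finset.subset_univ _) fun i _ hi => by
      simp only [Finset.mem_insert, Finset.mem_singleton, not_or] at hi
      exact h i hi.1 hi.2
  funext i
  by_cases hix : i = x
  · subst hix; simp [Pi.single_eq_of_ne hxy]
  · by_cases hiy : i = y
    · subst hiy; simp [Pi.single_eq_of_ne hix]; omega
    · simp [hix, hiy, h i hix hiy]

theorem single_add_single_apply_ne_zero {x y l : Fin n} {a b : ℕ} (ha : a ≠ 0) (hb : b ≠ 0) :
    (Pi.single x a + Pi.single y b : Fin n → ℕ) l ≠ 0 ↔ l = x ∨ l = y := by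
  by_cases hx : l = x <;> by_cases hy : l = y <;> simp [Pi.single_apply, hx, hy, ha, hb]

theorem eq_single_of_apply_eq_sum {J : Fin n → ℕ} {D : ℕ} (hJ : ∑ i, J i = D) {x : Fin n}
    (hx : J x = D) : J = Pi.single x D := by
  have h := Finset.add_sum_erase Finset.univ J (Finset.mem_univ x)
  have h0 : ∑ i ∈ Finset.univ.erase x, J i = 0 := by omega
  funext i
  by_cases hix : i = x
  · subst hix; simp [hx]
  · simpa [hix] using Finset.sum_eq_zero_iff.1 h0 i (by simp [hix])

theorem isHub_piAntidiag (d : ℕ) (h : Fin n) :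
    IsHub d (Finset.piAntidiag (Finset.univ : Finset (Fin n)) (d - 1)) h where
  sum_eq J hJ := (Finset.mem_piAntidiag.1 hJ).1
  mem i hi j hj := by
    refine Finset.mem_piAntidiag.2 ⟨?_, fun _ _ => Finset.mem_univ _⟩
    simp only [Pi.add_apply, Finset.sum_add_distrib, Finset.sum_pi_single', Finset.mem_univ,
      if_true]
    omega

theorem IsHub.subset_piAntidiag {S : Finset (Fin n → ℕ)} {h : Fin n} (hS : IsHub d S h) :
    S ⊆ Finset.piAntidiag (Finset.univ : Finset (Fin n)) (d - 1) := fun J hJ =>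
  Finset.mem_piAntidiag.2 ⟨hS.sum_eq J hJ, fun _ _ => Finset.mem_univ _⟩

/-- The labels of the basis vectors in `M(d,n)`. -/
def labelsM (d n : ℕ) : Finset (Fin n → ℕ) :=
  Finset.univ.image (fun i => Pi.single i (d - 1)) ∪
    (Finset.univ.sigma fun i : Fin n => (Finset.Ioi i) ×ˢ Finset.Icc 1 (d - 2)).image
      fun p => Pi.single p.1 p.2.2 + Pi.single p.2.1 (d - p.2.2 - 1)

theorem mem_labelsM {J : Fin n → ℕ} : J ∈ labelsM d n ↔ (∃ i, J = Pi.single i (d - 1)) ∨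
    ∃ i k j, i < k ∧ 1 ≤ j ∧ j ≤ d - 2 ∧ J = Pi.single i j + Pi.single k (d - j - 1) := by
  simp only [labelsM, Finset.mem_union, Finset.mem_image, Finset.mem_univ, true_and,
    Finset.mem_sigma, Finset.mem_product, Finset.mem_Ioi, Finset.mem_Icc]
  refine or_congr ⟨fun ⟨i, h⟩ => ⟨i, h.symm⟩, fun ⟨i, h⟩ => ⟨i, h.symm⟩⟩ ⟨?_, ?_⟩
  · rintro ⟨⟨i, k, j⟩, ⟨h1, h2, h3⟩, h⟩
    exact ⟨i, k, j, h1, h2, h3, h.symm⟩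
  · rintro ⟨i, k, j, h1, h2, h3, h⟩
    exact ⟨⟨i, k, j⟩, ⟨h1, h2, h3⟩, h.symm⟩

theorem stateM_eq_supportState (hd : 2 ≤ d) : stateM d n = supportState d (labelsM d n) := by
  rw [supportState, labelsM, Finset.sum_union, Finset.sum_image, Finset.sum_image, stateM,
    Finset.sum_sigma]
  · simp_rw [Finset.sum_product]
  · rintro ⟨i, k, j⟩ h ⟨i', k', j'⟩ h' heq
    simp only [Finset.coe_sigma, Set.mem_sigma_iff, Finset.mem_coe, Finset.mem_univ, true_and,
      Finset.mem_product, Finset.mem_Ioi, Finset.mem_Icc] at h h'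
    obtain ⟨hik, hj1, hj2⟩ := h
    obtain ⟨hik', hj1', hj2'⟩ := h'
    have hmem : ∀ l, (l = i ∨ l = k) ↔ (l = i' ∨ l = k') := fun l => by
      rw [← single_add_single_apply_ne_zero (a := j) (b := d - j - 1) (by omega) (by omega),
        ← single_add_single_apply_ne_zero (a := j') (b := d - j' - 1) (by omega) (by omega)]
      exact not_congr (iff_of_eq (congrArg (· = 0) (congrFun heq l)))
    obtain ⟨rfl, rfl⟩ : i = i' ∧ k = k' := by
      rcases (hmem i).1 (Or.inl rfl) with h1 | h1 <;>
        rcases (hmem k).1 (Or.inr rfl) with h2 | h2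
      · subst h1; subst h2; order
      · exact ⟨h1, h2⟩
      · subst h1; subst h2; order
      · subst h1; subst h2; order
    have hj := congrFun heq i
    simp only [Pi.add_apply, Pi.single_eq_same, Pi.single_eq_of_ne hik.ne, add_zero] at hj
    rw [hj]
  · intro i _ i' _ heq
    have := congrFun heq i
    by_contra hne
    simp [hne] at this
    omega
  · rw [Finset.disjoint_left]
    intro J hJ hJ'
    simp only [Finset.mem_image, Finset.mem_univ, true_and, Finset.mem_sigma, Finset.mem_product,
      Finset.mem_Ioi, Finset.mem_Icc] at hJ hJ'
    obtain ⟨i, rfl⟩ := hJ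
    obtain ⟨⟨i', k, j⟩, ⟨h1, h2, h3⟩, h⟩ := hJ'
    dsimp only at h1 h2 h3
    have hmem : ∀ l, l = i' ∨ l = k → l = i := fun l hl => by
      by_contra hne
      refine (single_add_single_apply_ne_zero (a := j) (b := d - j - 1) (by omega)
        (by omega)).2 hl ((congrFun h l).trans ?_)
      simp [hne]
    exact h1.ne ((hmem i' (Or.inl rfl)).trans (hmem k (Or.inr rfl)).symm)

theorem isHub_labelsM (d : ℕ) (h : Fin n) (hd : 2 ≤ d) : IsHub d (labelsM d n) h where
  sum_eq J hJ := by
    rcases mem_labelsM.1 hJ with ⟨i, rfl⟩ | ⟨i, k, j, h1, h2, h3, rfl⟩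
    · simp
    · simp only [Pi.add_apply, Finset.sum_add_distrib, Finset.sum_pi_single', Finset.mem_univ,
        if_true]
      omega
  mem i hi j hj := by
    rw [mem_labelsM]
    rcases Nat.eq_zero_or_pos j with rfl | hj0
    · exact Or.inl ⟨h, by simp⟩
    · rcases hj.eq_or_lt with rfl | hj1
      · exact Or.inl ⟨i, by simp⟩
      · rcases lt_or_gt_of_ne hi with hih | hih
        · exact Or.inr ⟨i, h, j, hih, hj0, by omega, by rw [Nat.sub_right_comm]⟩
        · refine Or.inr ⟨h, i, d - 1 - j, hih, by omega, by omega, ?_⟩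
          rw [add_comm, show d - (d - 1 - j) - 1 = j by omega]

/-- The weights of the degeneration of `L(d,n)` to `M(d,n)`: the total weight of a label is the
number of its nonzero entries, except that the labels with a single one also get weight 2. -/
def weightM (d : ℕ) (j : ℕ) : ℕ := if j = 0 then 0 else if j = d - 1 then 2 else 1

/-- Among the labels of `L(d,n)`, those of `M(d,n)` are the ones of least weight, which is 2. -/
theorem weightM_spec (hd : 2 ≤ d) {J : Fin n → ℕ} (hJ : ∑ i, J i = d - 1) :
    2 ≤ ∑ i, weightM d (J i) ∧ (∑ i, weightM d (J i) = 2 ↔ J ∈ labelsM d n) := by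
  by_cases h : ∃ x, J x = d - 1
  · obtain ⟨x, hx⟩ := h
    have hJx := eq_single_of_apply_eq_sum hJ hx
    have hw : ∑ i, weightM d (J i) = 2 := by
      rw [Finset.sum_eq_single x]
      · simp [weightM, hx]; omega
      · intro i _ hi
        rw [hJx]; simp [hi, weightM]
      · simp
    exact ⟨hw.ge, fun _ => mem_labelsM.2 (Or.inl ⟨x, hJx⟩), fun _ => hw⟩
  · push Not at h
    have hw : ∑ i, weightM d (J i) = (Finset.univ.filter fun i => J i ≠ 0).card := by
      rw [Finset.card_filter]
      refine Finset.sum_congr rfl fun i _ => ?_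
      by_cases hi : J i = 0 <;> simp [weightM, hi, h i]
    rw [hw]
    obtain ⟨x, hx⟩ : ∃ x, J x ≠ 0 := by
      by_contra! h0
      simp [h0] at hJ
      omega
    obtain ⟨y, hyx, hy⟩ : ∃ y, y ≠ x ∧ J y ≠ 0 := by
      by_contra! h0
      rw [Finset.sum_eq_single x (fun i _ hi => h0 i hi) (by simp)] at hJ
      exact h x hJ
    refine ⟨Finset.one_lt_card.2 ⟨x, by simpa using hx, y, by simpa using hy, hyx.symm⟩,
      fun h2 => ?_, fun hmem => ?_⟩
    · obtain ⟨x, y, hxy, hs⟩ := Finset.card_eq_two.1 h2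
      have hmem : ∀ i, J i ≠ 0 ↔ i = x ∨ i = y := fun i => by
        have := Finset.ext_iff.1 hs i
        simpa using this
      rw [eq_single_add_single hJ hxy fun i hix hiy => by
        by_contra h0
        exact ((hmem i).1 h0).elim hix hiy]
      refine (isHub_labelsM d y hd).mem x hxy _ ?_
      rw [← hJ]
      exact Finset.single_le_sum (fun _ _ => Nat.zero_le _) (Finset.mem_univ x)
    · rcases mem_labelsM.1 hmem with ⟨i, hi⟩ | ⟨i, k, j, h1, h2, h3, hJ'⟩
      · exact absurd (by simp [hi]) (h i)
      · rw [Finset.card_eq_two]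
        refine ⟨i, k, h1.ne, ?_⟩
        ext l
        rw [Finset.mem_filter, hJ', single_add_single_apply_ne_zero (by omega) (by omega)]
        simp

/-- The labels of the basis vectors in `N(d,n+1)`. -/
def labelsN (d n : ℕ) : Finset (Fin (n + 1) → ℕ) :=
  insert (Pi.single (Fin.last n) (d - 1))
    (((Finset.univ : Finset (Fin n)) ×ˢ Finset.Icc 1 (d - 1)).image
      fun p => Pi.single p.1.castSucc p.2 + Pi.single (Fin.last n) (d - p.2 - 1))

theorem mem_labelsN {J : Fin (n + 1) → ℕ} : J ∈ labelsN d n ↔ J = Pi.single (Fin.last n) (d - 1) ∨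
    ∃ (i : Fin n) (j : ℕ), 1 ≤ j ∧ j ≤ d - 1 ∧
      J = Pi.single i.castSucc j + Pi.single (Fin.last n) (d - j - 1) := by
  simp only [labelsN, Finset.mem_insert, Finset.mem_image, Finset.mem_univ, true_and,
    Finset.mem_product, Finset.mem_Icc, Prod.exists]
  refine or_congr Iff.rfl ⟨?_, ?_⟩
  · rintro ⟨i, j, ⟨h1, h2⟩, h⟩
    exact ⟨i, j, h1, h2, h.symm⟩
  · rintro ⟨i, j, h1, h2, h⟩
    exact ⟨i, j, ⟨h1, h2⟩, h.symm⟩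

theorem stateN_eq_supportState : stateN d (n + 1) = supportState d (labelsN d n) := by
  rw [supportState, labelsN, Finset.sum_insert, Finset.sum_image, stateN, Finset.sum_product]
  · rintro ⟨i, j⟩ h ⟨i', j'⟩ h' heq
    simp only [Finset.coe_product, Set.mem_prod, Finset.mem_coe, Finset.mem_univ, true_and,
      Finset.mem_Icc] at h h'
    have e1 := congrFun heq i.castSucc
    simp only [Pi.add_apply, Pi.single_apply, if_true, Fin.castSucc_inj,
      if_neg (Fin.castSucc_ne_last _), add_zero] at e1
    split_ifs at e1 with hi
    · rw [hi, e1]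
    · omega
  · intro hmem
    simp only [Finset.mem_image, Finset.mem_product, Finset.mem_univ, true_and, Finset.mem_Icc,
      Prod.exists] at hmem
    obtain ⟨i, j, hj, h⟩ := hmem
    have := congrFun h i.castSucc
    simp at this
    omega

theorem isHub_labelsN (d n : ℕ) (hd : 2 ≤ d) : IsHub d (labelsN d n) (Fin.last n) where
  sum_eq J hJ := by
    rcases mem_labelsN.1 hJ with rfl | ⟨i, j, h2, h3, rfl⟩
    · simp
    · simp only [Pi.add_apply, Finset.sum_add_distrib, Finset.sum_pi_single', Finset.mem_univ,
        if_true]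
      omega
  mem i hi j hj := by
    rw [mem_labelsN]
    rcases Nat.eq_zero_or_pos j with rfl | hj0
    · exact Or.inl (by simp)
    · refine Or.inr ⟨i.castPred hi, j, hj0, hj, ?_⟩
      rw [Fin.castSucc_castPred, Nat.sub_right_comm]

/-- The label set of `N(d,n+1)` is the least one for which the last party is a hub. -/
theorem labelsN_subset_of_isHub (hn : n ≠ 0) {S : Finset (Fin (n + 1) → ℕ)}
    (hS : IsHub d S (Fin.last n)) : labelsN d n ⊆ S := by
  intro J hJ
  rcases mem_labelsN.1 hJ with rfl | ⟨i, j, h2, h3, rfl⟩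
  · have := hS.mem (Fin.castSucc ⟨0, Nat.pos_of_ne_zero hn⟩) (Fin.castSucc_ne_last _) 0
      (Nat.zero_le _)
    simpa using this
  · rw [Nat.sub_right_comm]
    exact hS.mem _ (Fin.castSucc_ne_last i) j h3

/-- The weights of the degeneration to `N(d,n+1)`: the total weight of a label is the number of its
nonzero entries at the parties other than the last one, except that the label without such entries
gets weight 1. -/
def weightN (d n : ℕ) (i : Fin (n + 1)) (j : ℕ) : ℕ :=
  if i = Fin.last n then (if j = d - 1 then 1 else 0) else (if j = 0 then 0 else 1)

/-- Among the labels of `L(d,n+1)`, those of `N(d,n+1)` are the ones of least weight, which is 1. -/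
theorem weightN_spec (hd : 2 ≤ d) {J : Fin (n + 1) → ℕ} (hJ : ∑ i, J i = d - 1) :
    1 ≤ ∑ i, weightN d n i (J i) ∧ (∑ i, weightN d n i (J i) = 1 ↔ J ∈ labelsN d n) := by
  have hw : ∑ i, weightN d n i (J i) =
      (Finset.univ.filter fun i : Fin n => J i.castSucc ≠ 0).card +
        if J (Fin.last n) = d - 1 then 1 else 0 := by
    rw [Fin.sum_univ_castSucc, Finset.card_filter]
    simp [weightN]
  rw [hw]
  by_cases hl : J (Fin.last n) = d - 1
  · have hJl := eq_single_of_apply_eq_sum hJ hl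
    have h0 : (Finset.univ.filter fun i : Fin n => J i.castSucc ≠ 0) = ∅ :=
      Finset.filter_eq_empty_iff.2 fun i _ => by rw [hJl]; simp
    rw [h0, if_pos hl]
    exact ⟨le_rfl, fun _ => mem_labelsN.2 (Or.inl hJl), fun _ => rfl⟩
  · rw [if_neg hl, add_zero]
    obtain ⟨x, hx⟩ : ∃ x : Fin n, J x.castSucc ≠ 0 := by
      by_contra! h0
      rw [Fin.sum_univ_castSucc] at hJ
      simp [h0] at hJ
      exact hl hJ
    refine ⟨Finset.card_pos.2 ⟨x, by simpa using hx⟩, fun h1 => ?_, fun hmem => ?_⟩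
    · obtain ⟨x, hs⟩ := Finset.card_eq_one.1 h1
      have hmem : ∀ i : Fin n, J i.castSucc ≠ 0 ↔ i = x := fun i => by
        have := Finset.ext_iff.1 hs i
        simpa using this
      rw [eq_single_add_single hJ (Fin.castSucc_ne_last x) fun i hix hil => by
        obtain ⟨i, rfl⟩ := Fin.exists_castSucc_eq.2 hil
        by_contra h0
        exact hix (congrArg Fin.castSucc ((hmem i).1 h0))]
      refine (isHub_labelsN d n hd).mem _ (Fin.castSucc_ne_last x) _ ?_
      rw [← hJ]
      exact Finset.single_le_sum (fun _ _ => Nat.zero_le _) (Finset.mem_univ _)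
    · rcases mem_labelsN.1 hmem with h | ⟨i, j, h2, h3, hJ'⟩
      · exact absurd (by simp [h]) hl
      · rw [Finset.card_eq_one]
        refine ⟨i, ?_⟩
        ext l
        simp only [Finset.mem_filter, Finset.mem_univ, true_and, Finset.mem_singleton, hJ',
          Pi.add_apply, Pi.single_apply, Fin.castSucc_inj, if_neg (Fin.castSucc_ne_last _)]
        split_ifs with hli <;> simp [hli]
        omega

end Labels

end MultiquditSLOCC

open MultiquditSLOCC in
theorem mainTheorem9 (d n : ℕ) (hd : 2 ≤ d) (hn : 2 ≤ n) :
    MultiquditSLOCC.HasSLOCCRate (MultiquditSLOCC.stateL d n) (MultiquditSLOCC.stateM d n) 1 ∧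
    MultiquditSLOCC.HasSLOCCRate (MultiquditSLOCC.stateM d n) (MultiquditSLOCC.stateN d n) 1 ∧
    MultiquditSLOCC.HasSLOCCRate (MultiquditSLOCC.stateL d n) (MultiquditSLOCC.stateN d n) 1 := by
  obtain ⟨n, rfl⟩ := Nat.exists_eq_add_of_le' (show 1 ≤ n by omega)
  have hn0 : n ≠ 0 := by omega
  have hp : ∃ p : Fin (n + 1), p ≠ Fin.last n :=
    ⟨Fin.castSucc ⟨0, by omega⟩, Fin.castSucc_ne_last _⟩
  have hL := isHub_piAntidiag d (Fin.last n)
  have hM := isHub_labelsM d (Fin.last n) hd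
  have hN := isHub_labelsN d n hd
  rw [show stateL d (n + 1) = supportState d _ from rfl, stateM_eq_supportState hd,
    stateN_eq_supportState]
  exact ⟨hL.hasSLOCCRate_one hd hM hp hM.subset_piAntidiag (fun _ => weightM d) 2
      (fun J hJ => (weightM_spec hd (hL.sum_eq J hJ)).1)
      (fun J hJ => (weightM_spec hd (hL.sum_eq J hJ)).2),
    hM.hasSLOCCRate_one hd hN hp (labelsN_subset_of_isHub hn0 hM) (weightN d n) 1
      (fun J hJ => (weightN_spec hd (hM.sum_eq J hJ)).1)
      (fun J hJ => (weightN_spec hd (hM.sum_eq J hJ)).2),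
    hL.hasSLOCCRate_one hd hN hp (labelsN_subset_of_isHub hn0 hL) (weightN d n) 1
      (fun J hJ => (weightN_spec hd (hL.sum_eq J hJ)).1)
      (fun J hJ => (weightN_spec hd (hL.sum_eq J hJ)).2)⟩
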